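/- Consider the two-sorted vocabulary $\{0,1,+,\cdot,|\,|,=_1,=_2,\le,\in\}$ with number variables $x,y,\dots$ and string (finite set) variables $X,Y,\dots$, where $|X|$ is the length of $X$ (one more than its largest element, $0$ for the empty set), and write $X(t)$ for $t\in X$. A formula is $\Sigma_0^B$ if all its quantifiers are bounded number quantifiers. The theory $V^0$ is axiomatized by $2\text{-}BASIC$ (the axioms B1–B12, L1, L2, SE of Cook and Nguyen) and the comprehension axioms $\exists X\le y\,\forall z<y\,(X(z)\leftrightarrow\varphi(z))$ for all $\Sigma_0^B$-formulas $\varphi$ (possibly with further free variables) in which $X$ is not free; $V^0\vdash\psi$ means that $\psi$ is a logical consequence of (the universal closures of) these axioms, i.e. holds in all two-sorted models of $V^0$. Let $\langle x,y\rangle=(x+y)(x+y+1)+2y$, and for strings $V,E$ write $E(i,j)$ for $E(\langle i,j\rangle)$. Predecessors $t-1$ are truncated at $0$. Define the following formulas. * $GRAPH(V,E)$, with $n=|V|$: $\forall i<n\,V(i)\ \wedge\ \forall i<j<n\,(E(i,j)\leftrightarrow E(j,i))\ \wedge\ \forall i<n\,\neg E(i,i)$. A graph is a pair $\mathcal G=(V_{\mathcal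 G},E_{\mathcal G})$ that satisfies $GRAPH$. * $MAP(n,m,Z)$: $\forall i<n\,\exists j<m\,Z(\langle i,j\rangle)\ \wedge\ \forall i<n\,\forall j_1,j_2<m\,(Z(\langle i,j_1\rangle)\wedge Z(\langle i,j_2\rangle)\to j_1=j_2)$. * $HOM(\mathcal G,\mathcal H)$, with $n=|V_{\mathcal G}|$, $m=|V_{\mathcal H}|$: there is $Z$ with $|Z|\le\langle n-1,m-1\rangle+1$ such that $MAP(n,m,Z)$ and $\forall i_1,i_2<n\,\forall j_1,j_2<m\,(E_{\mathcal G}(i_1,i_2)\wedge Z(\langle i_1,j_1\rangle)\wedge Z(\langle i_2,j_2\rangle)\to E_{\mathcal H}(j_1,j_2))$. * $BIP(\mathcal H)$, with $m=|V_{\mathcal H}|$: there are $W,U$ with $|W|,|U|\le m$ such that $\forall i<m\,(W(i)\leftrightarrow\neg U(i))$ and $\forall i<j<m\,(E_{\mathcal H}(i,j)\to(W(i)\wedge U(j))\vee(W(j)\wedge U(i)))$. * $CYCLE(V,E)$, with $k=|V|\ge1$: $E(0,k-1)\ \wedge\ \forall i<k-1\,E(i,i+1)\ \wedge\ \forall i<j<k\,\bigl(j\ne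 i+1\wedge\neg(i=0\wedge j=k-1)\to\neg E(i,j)\bigr)$. * $NONBIP(\mathcal G)$, with $n=|V_{\mathcal G}|$: there are a number $k$ with $1\le k\le n$ and $2\mid k-1$, and strings $V_C,E_C$ with $|V_C|=k$ and $|E_C|<4k^2$, such that $\mathcal C=(V_C,E_C)$ satisfies $GRAPH(\mathcal C)$, $CYCLE(\mathcal C)$ and $HOM(\mathcal C,\mathcal G)$. **Theorem.** For all non-bipartite graphs $\mathcal G$ and bipartite graphs $\mathcal H$, $V^0$ proves that there is no homomorphism from $\mathcal G$ to $\mathcal H$: $$V^0\vdash\forall \mathcal G,\mathcal H\ \bigl(BIP(\mathcal H)\wedge NONBIP(\mathcal G)\to\neg HOM(\mathcal G,\mathcal H)\bigr),$$ where the quantifiers range over strings $V_{\mathcal G},E_{\mathcal G},V_{\mathcal H},E_{\mathcal H}$ with $GRAPH(V_{\mathcal G},E_{\mathcal G})$ and $GRAPH(V_{\mathcal H},E_{\mathcal H})$. -/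

import Mathlib

universe u v

namespace BoundedArith

/-! ## Syntax: the two-sorted vocabulary with symbols 0, 1, +, *, |.|, =₁, =₂, ≤, ∈

Variables of each sort are named by natural numbers: there are number variables and string (set)
variables.  The vocabulary has no string function symbols, so the string terms are exactly the
string variables. -/

/-- Number terms; `len X` is the term `|X|` for the string variable named `X`. -/
inductive NumTerm : Type
  | var (x : ℕ) : NumTerm
  | zero : NumTerm
  | one : NumTerm
  | add (s t : NumTerm) : NumTerm
  | mul (s t : NumTerm) : NumTerm
  | len (X : ℕ) : NumTerm

/-- Two-sorted first-order formulas. -/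
inductive Formula : Type
  | eqNum (s t : NumTerm) : Formula
  | eqStr (X Y : ℕ) : Formula
  | le (s t : NumTerm) : Formula
  | mem (t : NumTerm) (X : ℕ) : Formula
  | neg (φ : Formula) : Formula
  | and (φ ψ : Formula) : Formula
  | or (φ ψ : Formula) : Formula
  | allNum (x : ℕ) (φ : Formula) : Formula
  | exNum (x : ℕ) (φ : Formula) : Formula
  | allStr (X : ℕ) (φ : Formula) : Formula
  | exStr (X : ℕ) (φ : Formula) : Formula

/-- The number variable `x` occurs in the term. -/
def NumTerm.HasVar (x : ℕ) : NumTerm → Prop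
  | .var y => x = y
  | .zero => False
  | .one => False
  | .add s t => s.HasVar x ∨ t.HasVar x
  | .mul s t => s.HasVar x ∨ t.HasVar x
  | .len _ => False

/-- The string variable `X` occurs in the term. -/
def NumTerm.HasStr (X : ℕ) : NumTerm → Prop
  | .var _ => False
  | .zero => False
  | .one => False
  | .add s t => s.HasStr X ∨ t.HasStr X
  | .mul s t => s.HasStr X ∨ t.HasStr X
  | .len Y => X = Y

namespace Formula

/-- The string variable `X` occurs free in the formula. -/
def FreeStr (X : ℕ) : Formula → Prop
  | .eqNum s t => s.HasStr X ∨ t.HasStr X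
  | .eqStr Y Z => X = Y ∨ X = Z
  | .le s t => s.HasStr X ∨ t.HasStr X
  | .mem t Y => t.HasStr X ∨ X = Y
  | .neg φ => φ.FreeStr X
  | .and φ ψ => φ.FreeStr X ∨ ψ.FreeStr X
  | .or φ ψ => φ.FreeStr X ∨ ψ.FreeStr X
  | .allNum _ φ => φ.FreeStr X
  | .exNum _ φ => φ.FreeStr X
  | .allStr Y φ => X ≠ Y ∧ φ.FreeStr X
  | .exStr Y φ => X ≠ Y ∧ φ.FreeStr X

/-- `φ → ψ` -/
def imp (φ ψ : Formula) : Formula := (neg φ).or ψ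

/-- `φ ↔ ψ` -/
def iff (φ ψ : Formula) : Formula := (φ.imp ψ).and (ψ.imp φ)

/-- `s ≠ t` -/
def ne (s t : NumTerm) : Formula := neg (eqNum s t)

/-- `s < t`, an abbreviation of `s ≤ t ∧ s ≠ t` -/
def lt (s t : NumTerm) : Formula := (le s t).and (ne s t)

/-- `∃ x ≤ t, φ` -/
def exLe (x : ℕ) (t : NumTerm) (φ : Formula) : Formula := exNum x ((le (.var x) t).and φ)

/-- `∀ x ≤ t, φ` -/
def allLe (x : ℕ) (t : NumTerm) (φ : Formula) : Formula := allNum x ((le (.var x) t).imp φ)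

/-- `∀ x < t, φ` -/
def allLt (x : ℕ) (t : NumTerm) (φ : Formula) : Formula :=
  allLe x t ((ne (.var x) t).imp φ)

/-- `∃ x < t, φ` -/
def exLt (x : ℕ) (t : NumTerm) (φ : Formula) : Formula :=
  exLe x t ((ne (.var x) t).and φ)

/-- `∃ X ≤ t, φ`, that is, `∃ X, |X| ≤ t ∧ φ` -/
def exStrLe (X : ℕ) (t : NumTerm) (φ : Formula) : Formula := exStr X ((le (.len X) t).and φ)

/-- The class `Σ₀ᴮ`: all quantifiers are bounded number quantifiers. -/
inductive IsSigma0B : Formula → Prop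
  | eqNum (s t : NumTerm) : IsSigma0B (.eqNum s t)
  | eqStr (X Y : ℕ) : IsSigma0B (.eqStr X Y)
  | le (s t : NumTerm) : IsSigma0B (.le s t)
  | mem (t : NumTerm) (X : ℕ) : IsSigma0B (.mem t X)
  | neg {φ : Formula} : IsSigma0B φ → IsSigma0B (.neg φ)
  | and {φ ψ : Formula} : IsSigma0B φ → IsSigma0B ψ → IsSigma0B (.and φ ψ)
  | or {φ ψ : Formula} : IsSigma0B φ → IsSigma0B ψ → IsSigma0B (.or φ ψ)
  | exLe {x : ℕ} {t : NumTerm} {φ : Formula} :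
      ¬ t.HasVar x → IsSigma0B φ → IsSigma0B (exLe x t φ)
  | allLe {x : ℕ} {t : NumTerm} {φ : Formula} :
      ¬ t.HasVar x → IsSigma0B φ → IsSigma0B (allLe x t φ)

end Formula

/-! ## Semantics and theories -/

/-- Two-sorted structures for the vocabulary (both universes non-empty).  The two equality symbols
are interpreted by true equality. -/
structure TwoSortedStructure : Type (max (u + 1) (v + 1)) where
  Num : Type u
  Str : Type v
  str_nonempty : Nonempty Str
  zero : Num
  one : Num
  add : Num → Num → Num
  mul : Num → Num → Num
  len : Str → Num
  le : Num → Num → Prop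
  mem : Num → Str → Prop

/-- Value of a term under an assignment `ν` of the number variables and `σ` of the string
variables. -/
def NumTerm.eval (M : TwoSortedStructure.{u, v}) (ν : ℕ → M.Num) (σ : ℕ → M.Str) :
    NumTerm → M.Num
  | .var x => ν x
  | .zero => M.zero
  | .one => M.one
  | .add s t => M.add (s.eval M ν σ) (t.eval M ν σ)
  | .mul s t => M.mul (s.eval M ν σ) (t.eval M ν σ)
  | .len X => M.len (σ X)

/-- Tarski satisfaction `M ⊨ φ[ν, σ]`. -/
def Formula.Sat (M : TwoSortedStructure.{u, v}) :
    (ℕ → M.Num) → (ℕ → M.Str) → Formula → Prop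
  | ν, σ, .eqNum s t => s.eval M ν σ = t.eval M ν σ
  | _, σ, .eqStr X Y => σ X = σ Y
  | ν, σ, .le s t => M.le (s.eval M ν σ) (t.eval M ν σ)
  | ν, σ, .mem t X => M.mem (t.eval M ν σ) (σ X)
  | ν, σ, .neg φ => ¬ Formula.Sat M ν σ φ
  | ν, σ, .and φ ψ => Formula.Sat M ν σ φ ∧ Formula.Sat M ν σ ψ
  | ν, σ, .or φ ψ => Formula.Sat M ν σ φ ∨ Formula.Sat M ν σ ψ
  | ν, σ, .allNum x φ => ∀ a : M.Num, Formula.Sat M (Function.update ν x a) σ φ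
  | ν, σ, .exNum x φ => ∃ a : M.Num, Formula.Sat M (Function.update ν x a) σ φ
  | ν, σ, .allStr X φ => ∀ A : M.Str, Formula.Sat M ν (Function.update σ X A) φ
  | ν, σ, .exStr X φ => ∃ A : M.Str, Formula.Sat M ν (Function.update σ X A) φ

/-- `M` is a model of (the universal closures of) the axioms in `T`. -/
def IsModel (M : TwoSortedStructure.{u, v}) (T : Set Formula) : Prop :=
  ∀ φ ∈ T, ∀ (ν : ℕ → M.Num) (σ : ℕ → M.Str), φ.Sat M ν σ

/-- `T ⊢ φ`.  As is usual in two-sorted bounded arithmetic (Cook and Nguyen, *Logical Foundations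
of Proof Complexity*), the theory axiomatized by `T` is the set of all formulas that are logical
consequences of the universal closures of the axioms, and `T ⊢ φ` means that `φ` belongs to it:
every two-sorted structure that is a model of `T` satisfies (the universal closure of) `φ`. -/
def Proves (T : Set Formula) (φ : Formula) : Prop :=
  ∀ M : TwoSortedStructure.{u, v}, IsModel M T →
    ∀ (ν : ℕ → M.Num) (σ : ℕ → M.Str), φ.Sat M ν σ

/-! ## The theory `V⁰` -/

section Axioms

open NumTerm Formula

/-- The axioms `2-BASIC`: B1 to B12, L1, L2 and extensionality SE, in this order. -/
inductive TwoBasic : Formula → Prop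
  /-- `x + 1 ≠ 0` -/
  | B1 : TwoBasic (ne (add (var 0) one) zero)
  /-- `x + 1 = y + 1 → x = y` -/
  | B2 : TwoBasic ((eqNum (add (var 0) one) (add (var 1) one)).imp (eqNum (var 0) (var 1)))
  /-- `x + 0 = x` -/
  | B3 : TwoBasic (eqNum (add (var 0) zero) (var 0))
  /-- `x + (y + 1) = (x + y) + 1` -/
  | B4 : TwoBasic (eqNum (add (var 0) (add (var 1) one)) (add (add (var 0) (var 1)) one))
  /-- `x * 0 = 0` -/
  | B5 : TwoBasic (eqNum (mul (var 0) zero) zero)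
  /-- `x * (y + 1) = x * y + x` -/
  | B6 : TwoBasic (eqNum (mul (var 0) (add (var 1) one)) (add (mul (var 0) (var 1)) (var 0)))
  /-- `x ≤ y ∧ y ≤ x → x = y` -/
  | B7 : TwoBasic
      (((Formula.le (var 0) (var 1)).and (Formula.le (var 1) (var 0))).imp
        (eqNum (var 0) (var 1)))
  /-- `x ≤ x + y` -/
  | B8 : TwoBasic (Formula.le (var 0) (add (var 0) (var 1)))
  /-- `0 ≤ x` -/
  | B9 : TwoBasic (Formula.le zero (var 0))
  /-- `x ≤ y ∨ y ≤ x` -/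
  | B10 : TwoBasic ((Formula.le (var 0) (var 1)).or (Formula.le (var 1) (var 0)))
  /-- `x ≤ y ↔ x < y + 1` -/
  | B11 : TwoBasic ((Formula.le (var 0) (var 1)).iff (Formula.lt (var 0) (add (var 1) one)))
  /-- `x ≠ 0 → ∃ y ≤ x, y + 1 = x` -/
  | B12 : TwoBasic
      ((ne (var 0) zero).imp (exLe 1 (var 0) (eqNum (add (var 1) one) (var 0))))
  /-- `X(y) → y < |X|` -/
  | L1 : TwoBasic ((mem (var 0) 0).imp (Formula.lt (var 0) (len 0)))
  /-- `y + 1 = |X| → X(y)` -/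
  | L2 : TwoBasic ((eqNum (add (var 0) one) (len 0)).imp (mem (var 0) 0))
  /-- `|X| = |Y| ∧ ∀ i < |X|, (X(i) ↔ Y(i)) → X = Y` -/
  | SE : TwoBasic
      (((eqNum (len 0) (len 1)).and
        (allLt 0 (len 0) ((mem (var 0) 0).iff (mem (var 0) 1)))).imp (eqStr 0 1))

/-- The comprehension axiom `∃ X ≤ y, ∀ z < y, (X(z) ↔ φ(z))`. -/
def comprehension (X y z : ℕ) (φ : Formula) : Formula :=
  exStrLe X (var y) (allLt z (var y) ((mem (var z) X).iff φ))

/-- The theory `V⁰`: the axioms `2-BASIC` together with comprehension for all `Σ₀ᴮ` formulas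
`φ`, where `X` is not free in `φ`. The formula `φ` may have further free variables. -/
def V0 : Set Formula :=
  {φ | TwoBasic φ} ∪
    {ψ | ∃ (X y z : ℕ) (φ : Formula), φ.IsSigma0B ∧ ¬ φ.FreeStr X ∧ y ≠ z ∧
      ψ = comprehension X y z φ}

end Axioms

/-! ## Graphs, homomorphisms, bipartite and non-bipartite graphs as formulas

A graph is given by two string variables `V` (vertices) and `E` (edges); its number of vertices
is the term `|V|`.  Bound string variables are chosen different from all parameters. -/

section Graphs

open NumTerm Formula

/-- The pairing term `⟨s, t⟩ = (s + t) * (s + t + 1) + 2 * t`. -/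
def pair (s t : NumTerm) : NumTerm :=
  add (mul (add s t) (add (add s t) one)) (mul (add one one) t)

/-- `R(⟨s, t⟩)` -/
def rel (R : ℕ) (s t : NumTerm) : Formula := mem (pair s t) R

/-- Divisibility `s ∣ t`, that is, `∃ z ≤ t, s * z = t`; the variable `z` must not occur in
`s`, `t`. -/
def dvd (z : ℕ) (s t : NumTerm) : Formula := exLe z t (eqNum (mul s (var z)) t)

/-- `GRAPH(V, E)`: with `n = |V|`, all `i < n` are in `V`, and on `{0, …, n - 1}` the relation `E`
is symmetric and has no loops. -/
def graph (V E : ℕ) : Formula :=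
  (allLt 0 (len V) (mem (var 0) V)).and
    ((allLt 1 (len V) (allLt 0 (var 1)
        ((rel E (var 0) (var 1)).iff (rel E (var 1) (var 0))))).and
      (allLt 0 (len V) (neg (rel E (var 0) (var 0)))))

/-- `MAP(n, m, Z)` with `n = |V|`, `m = |V'|`: `Z` is a well-defined map from `{0, …, n - 1}` to
`{0, …, m - 1}`. -/
def map (V V' Z : ℕ) : Formula :=
  (allLt 0 (len V) (exLt 1 (len V') (rel Z (var 0) (var 1)))).and
    (allLt 0 (len V) (allLt 1 (len V') (allLt 2 (len V')
      (((rel Z (var 0) (var 1)).and (rel Z (var 0) (var 2))).imp (eqNum (var 1) (var 2))))))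

/-- `Z` maps edges to edges. -/
def preservesEdges (V E V' E' Z : ℕ) : Formula :=
  allLt 0 (len V) (allLt 1 (len V) (allLt 2 (len V') (allLt 3 (len V')
    (((rel E (var 0) (var 1)).and
      ((rel Z (var 0) (var 2)).and (rel Z (var 1) (var 3)))).imp (rel E' (var 2) (var 3))))))

/-- `s = t ∸ 1` (truncated predecessor) -/
def isPred (s t : NumTerm) : Formula :=
  (eqNum (add s one) t).or ((eqNum t zero).and (eqNum s zero))

/-- `HOM((V, E), (V', E'))`: with `n = |V|` and `m = |V'|` there is a set `Z` of codes of pairs,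
all of them at most `⟨n - 1, m - 1⟩` (so `|Z| ≤ ⟨n - 1, m - 1⟩ + 1`), that is a homomorphism. -/
def hom (V E V' E' : ℕ) : Formula :=
  let Z := V + E + V' + E' + 1
  exLe 0 (len V) (exLe 1 (len V')
    ((isPred (var 0) (len V)).and ((isPred (var 1) (len V')).and
      (exStrLe Z (add (pair (var 0) (var 1)) one)
        ((map V V' Z).and (preservesEdges V E V' E' Z))))))

/-- `BIP(V, E)`: with `m = |V|` there are complementary `W, U ≤ m` such that each edge has one
end in `W` and the other in `U`. -/
def bip (V E : ℕ) : Formula :=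
  let W := V + E + 1
  let U := V + E + 2
  exStrLe W (len V) (exStrLe U (len V)
    ((allLt 0 (len V) ((mem (var 0) W).iff (neg (mem (var 0) U)))).and
      (allLt 1 (len V) (allLt 0 (var 1)
        ((rel E (var 0) (var 1)).imp
          (((mem (var 0) W).and (mem (var 1) U)).or ((mem (var 1) W).and (mem (var 0) U))))))))

/-- `CYCLE(V, E)` for a graph with `k = |V| = p + 1` vertices: `0` and `k - 1` are adjacent, `i`
and `i + 1` are adjacent for `i < k - 1`, and there are no other edges. -/
def cycle (V E : ℕ) : Formula :=
  exLe 2 (len V) ((eqNum (add (var 2) one) (len V)).and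
    ((rel E zero (var 2)).and
      ((allLt 0 (var 2) (rel E (var 0) (add (var 0) one))).and
        (allLt 1 (len V) (allLt 0 (var 1)
          (((ne (var 1) (add (var 0) one)).and
            (neg ((eqNum (var 0) zero).and (eqNum (var 1) (var 2))))).imp
              (neg (rel E (var 0) (var 1)))))))))

/-- `NONBIP(V, E)`: with `n = |V|` there are `k ≤ n` with `2 ∣ k - 1` (the variables `0` and `1`
stand for `k` and `k - 1`) and a cycle `C = (V_C, E_C)` of length `k`, with `|V_C| = k` and
`|E_C| < 4 k ^ 2`, that has a homomorphism to `(V, E)`. -/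
def nonbip (V E : ℕ) : Formula :=
  let VC := V + E + 1
  let EC := V + E + 2
  exLe 0 (len V) (exLe 1 (var 0)
    ((eqNum (add (var 1) one) (var 0)).and ((dvd 2 (add one one) (var 1)).and
      (exStr VC ((eqNum (len VC) (var 0)).and
        (exStr EC ((Formula.lt (len EC)
            (mul (add (add one one) (add one one)) (mul (var 0) (var 0)))).and
          ((graph VC EC).and ((cycle VC EC).and (hom VC EC V E))))))))))

/-- The sentence `∀ G H, (BIP(H) ∧ NONBIP(G) → ¬ HOM(G, H))`, where the string quantifiers over
`G = (V_G, E_G)` and `H = (V_H, E_H)` (the variables `0, 1` and `2, 3`) are relativized to graphs. -/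
def noHomSentence : Formula :=
  allStr 0 (allStr 1 (allStr 2 (allStr 3
    (((graph 0 1).and (graph 2 3)).imp
      (((bip 2 3).and (nonbip 0 1)).imp (neg (hom 0 1 2 3)))))))

end Graphs

end BoundedArith

namespace BoundedArith

open NumTerm Formula

/-! In a model of `V0`, follow the odd cycle `0, …, p`, with `p = 2 * q`, through its map to `G` and
then through the map from `G` to `H`, and pull one colour class `W` of `H` back to a set `A` of
cycle vertices. Edges go to edges and every edge of `H` changes colour, so `A` changes value along
each edge of the cycle. Going from `0` to `p` takes an even number of steps, so `A` agrees at `0`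
and `p`; but the closing edge joins `0` and `p`, so `A` also differs there.

What needs care is that `V0` suffices. The composed homomorphism is never formed as a string: only
`A` is needed, and it is `Σ₀ᴮ`-definable from the two maps and `W` (`IsModel.exists_preimage`).
Parity is not counted: `A(2x) ↔ A(0)` is proved by induction on `x ≤ q`
(`IsModel.mem_iff_of_alternating`). Induction itself comes from comprehension and the length axioms
(`BasicLaws.induction`). -/

/-- The strict order of a structure. -/
def TwoSortedStructure.Lt (M : TwoSortedStructure.{u, v}) (a b : M.Num) : Prop :=
  M.le a b ∧ a ≠ b

/-- The value of the pairing term. -/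
def TwoSortedStructure.pr (M : TwoSortedStructure.{u, v}) (a b : M.Num) : M.Num :=
  M.add (M.mul (M.add a b) (M.add (M.add a b) M.one)) (M.mul (M.add M.one M.one) b)

/-! ### Reading the formulas in a structure -/

section Sat

variable {M : TwoSortedStructure.{u, v}} {ν : ℕ → M.Num} {σ : ℕ → M.Str}

theorem sat_imp {φ ψ : Formula} : (φ.imp ψ).Sat M ν σ ↔ (φ.Sat M ν σ → ψ.Sat M ν σ) := by
  simp only [Formula.imp, Formula.Sat]; tauto

theorem sat_iff {φ ψ : Formula} : (φ.iff ψ).Sat M ν σ ↔ (φ.Sat M ν σ ↔ ψ.Sat M ν σ) := by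
  simp only [Formula.iff, Formula.Sat, sat_imp]; tauto

theorem sat_lt {s t : NumTerm} :
    (Formula.lt s t).Sat M ν σ ↔ M.Lt (s.eval M ν σ) (t.eval M ν σ) := Iff.rfl

theorem sat_allLt {x : ℕ} {t : NumTerm} {φ : Formula} :
    (allLt x t φ).Sat M ν σ ↔ ∀ a, M.le a (t.eval M (Function.update ν x a) σ) →
      a ≠ t.eval M (Function.update ν x a) σ → φ.Sat M (Function.update ν x a) σ := by
  simp [allLt, allLe, Formula.Sat, sat_imp, Formula.ne, NumTerm.eval]

theorem sat_exLt {x : ℕ} {t : NumTerm} {φ : Formula} :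
    (exLt x t φ).Sat M ν σ ↔ ∃ a, M.le a (t.eval M (Function.update ν x a) σ) ∧
      a ≠ t.eval M (Function.update ν x a) σ ∧ φ.Sat M (Function.update ν x a) σ := by
  simp [exLt, exLe, Formula.Sat, Formula.ne, NumTerm.eval]

theorem sat_rel {R : ℕ} {s t : NumTerm} :
    (rel R s t).Sat M ν σ ↔ M.mem (M.pr (s.eval M ν σ) (t.eval M ν σ)) (σ R) := Iff.rfl

theorem sat_graph {V E : ℕ} : (graph V E).Sat M ν σ ↔
    (∀ i, M.Lt i (M.len (σ V)) → M.mem i (σ V)) ∧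
    (∀ j, M.Lt j (M.len (σ V)) → ∀ i, M.Lt i j →
      (M.mem (M.pr i j) (σ E) ↔ M.mem (M.pr j i) (σ E))) ∧
    (∀ i, M.Lt i (M.len (σ V)) → ¬ M.mem (M.pr i i) (σ E)) := by
  simp [graph, Formula.Sat, sat_allLt, sat_iff, sat_rel, NumTerm.eval, TwoSortedStructure.Lt]

/-- `Z` codes a homomorphism between graphs with `n` and `m` vertices and edge sets `E`, `E'`. -/
structure IsHom (M : TwoSortedStructure.{u, v}) (n m : M.Num) (E E' Z : M.Str) : Prop where
  total : ∀ i, M.Lt i n → ∃ j, M.Lt j m ∧ M.mem (M.pr i j) Z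
  unique : ∀ i, M.Lt i n → ∀ j, M.Lt j m → ∀ j', M.Lt j' m →
    M.mem (M.pr i j) Z → M.mem (M.pr i j') Z → j = j'
  edge : ∀ i, M.Lt i n → ∀ i', M.Lt i' n → ∀ j, M.Lt j m → ∀ j', M.Lt j' m →
    M.mem (M.pr i i') E → M.mem (M.pr i j) Z → M.mem (M.pr i' j') Z → M.mem (M.pr j j') E'

theorem exists_isHom_of_sat_hom {V E V' E' : ℕ} (h : (hom V E V' E').Sat M ν σ) :
    ∃ Z, IsHom M (M.len (σ V)) (M.len (σ V')) (σ E) (σ E') Z := by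
  -- The bound string variable differs from the four parameters, so updating the assignment at it
  -- leaves their values alone.
  have hV : V ≠ V + E + V' + E' + 1 := by omega
  have hE : E ≠ V + E + V' + E' + 1 := by omega
  have hV' : V' ≠ V + E + V' + E' + 1 := by omega
  have hE' : E' ≠ V + E + V' + E' + 1 := by omega
  simp only [hom, exLe, exStrLe, Formula.Sat] at h
  obtain ⟨_, -, _, -, -, -, Z, -, h₁, h₂⟩ := h
  simp [map, preservesEdges, Formula.Sat, sat_allLt, sat_exLt, sat_imp, sat_rel, NumTerm.eval,
    hV, hE, hV', hE'] at h₁ h₂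
  refine ⟨Z, fun i hi => ?_, fun i hi j hj j' hj' => h₁.2 i hi.1 hi.2 j hj.1 hj.2 j' hj'.1 hj'.2,
    fun i hi i' hi' j hj j' hj' =>
      h₂ i hi.1 hi.2 i' hi'.1 hi'.2 j hj.1 hj.2 j' hj'.1 hj'.2⟩
  obtain ⟨j, hj, hj', hij⟩ := h₁.1 i hi.1 hi.2
  exact ⟨j, ⟨hj, hj'⟩, hij⟩

/-- `BIP` constrains only pairs `i < j`; symmetry and the absence of loops extend this to all
ordered pairs. Since `U` is the complement of `W` on the vertices, `W` alone records the colouring.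
-/
theorem exists_coloring_of_sat_bip {V E : ℕ} (hG : (graph V E).Sat M ν σ)
    (hle : ∀ a b : M.Num, M.le a b ∨ M.le b a) (h : (bip V E).Sat M ν σ) :
    ∃ W, ∀ i, M.Lt i (M.len (σ V)) → ∀ j, M.Lt j (M.len (σ V)) →
      M.mem (M.pr i j) (σ E) → (M.mem i W ↔ ¬ M.mem j W) := by
  have h1 : V ≠ V + E + 1 := by omega
  have h2 : V ≠ V + E + 2 := by omega
  have h3 : E ≠ V + E + 1 := by omega
  have h4 : E ≠ V + E + 2 := by omega
  simp only [bip, exStrLe, Formula.Sat] at h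
  obtain ⟨W, -, U, -, h, h'⟩ := h
  simp [Formula.Sat, sat_allLt, sat_iff, sat_imp, sat_rel, NumTerm.eval, h1, h2, h3, h4] at h h'
  obtain ⟨-, hsymm, hloop⟩ := sat_graph.1 hG
  have key : ∀ j, M.Lt j (M.len (σ V)) → ∀ i, M.Lt i (M.len (σ V)) → M.Lt i j →
      M.mem (M.pr i j) (σ E) → (M.mem i W ↔ ¬ M.mem j W) := by
    intro j hj i hi hij hE
    have := h' j hj.1 hj.2 i hij.1 hij.2 hE
    have := h i hi.1 hi.2
    have := h j hj.1 hj.2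
    tauto
  refine ⟨W, fun i hi j hj hE => ?_⟩
  by_cases hne : i = j
  · subst hne; exact absurd hE (hloop i hi)
  rcases hle i j with hij | hij
  · exact key j hj i hi ⟨hij, hne⟩ hE
  · have := key i hi j hj ⟨hij, Ne.symm hne⟩ ((hsymm i hi j ⟨hij, Ne.symm hne⟩).2 hE)
    tauto

/-- What `NONBIP` says about the cycle: it has `p + 1` vertices, where `p = 2 * q`. -/
theorem exists_oddCycle_of_sat_nonbip {V E : ℕ} (h : (nonbip V E).Sat M ν σ)
    (hinj : ∀ a b : M.Num, M.add a M.one = M.add b M.one → a = b) :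
    ∃ (p q : M.Num) (C Z : M.Str), M.mul (M.add M.one M.one) q = p ∧
      M.mem (M.pr M.zero p) C ∧ (∀ i, M.Lt i p → M.mem (M.pr i (M.add i M.one)) C) ∧
      IsHom M (M.add p M.one) (M.len (σ V)) C (σ E) Z := by
  have h1 : V ≠ V + E + 1 := by omega
  have h2 : V ≠ V + E + 2 := by omega
  have h3 : E ≠ V + E + 1 := by omega
  have h4 : E ≠ V + E + 2 := by omega
  simp only [nonbip, exLe, dvd, Formula.Sat] at h
  obtain ⟨k, -, p, -, hk, ⟨q, -, hq⟩, VC, hVC, EC, -, -, hcyc, hhom⟩ := h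
  obtain ⟨Z, hZ⟩ := exists_isHom_of_sat_hom hhom
  simp [NumTerm.eval] at hk hq hVC
  simp [cycle, exLe, Formula.Sat, sat_allLt, sat_rel, NumTerm.eval] at hcyc
  simp [h1, h2, h3, h4] at hZ
  obtain ⟨p', -, hp', h0, hstep, -⟩ := hcyc
  -- `CYCLE` and `NONBIP` each name a predecessor of the cycle length; injectivity of successor
  -- identifies them.
  obtain rfl : p' = p := hinj _ _ (by rw [hp', hVC, hk])
  refine ⟨p', q, EC, Z, hq, h0, fun i hi => hstep i hi.1 hi.2, ?_⟩
  rwa [hp']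

end Sat

/-! ### Order and induction from `2-BASIC`, and uses of comprehension -/

section Arithmetic

variable {M : TwoSortedStructure.{u, v}}

/-- The axioms of `2-BASIC` that the proof uses, read in a structure. -/
structure BasicLaws (M : TwoSortedStructure.{u, v}) : Prop where
  add_one_inj : ∀ a b, M.add a M.one = M.add b M.one → a = b
  add_add_one : ∀ a b, M.add a (M.add b M.one) = M.add (M.add a b) M.one
  mul_zero : ∀ a, M.mul a M.zero = M.zero
  mul_add_one : ∀ a b, M.mul a (M.add b M.one) = M.add (M.mul a b) a
  le_antisymm : ∀ a b, M.le a b → M.le b a → a = b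
  le_add : ∀ a b, M.le a (M.add a b)
  zero_le : ∀ a, M.le M.zero a
  le_total : ∀ a b, M.le a b ∨ M.le b a
  le_iff : ∀ a b, M.le a b ↔ M.Lt a (M.add b M.one)
  exists_pred : ∀ a, a ≠ M.zero → ∃ b, M.add b M.one = a
  lt_len : ∀ a S, M.mem a S → M.Lt a (M.len S)
  mem_of_len : ∀ a S, M.add a M.one = M.len S → M.mem a S

theorem IsModel.basicLaws (hM : IsModel M V0) : BasicLaws M := by
  obtain ⟨S₀⟩ := M.str_nonempty
  -- The axioms read off here have free number variables only among `0`, `1` and at most the string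
  -- variable `0`.
  let ν (a b : M.Num) : ℕ → M.Num := fun n => if n = 0 then a else b
  have ax {φ : Formula} (hφ : TwoBasic φ) (a b : M.Num) (S : M.Str) :
      φ.Sat M (ν a b) (fun _ => S) := hM φ (Or.inl hφ) _ _
  constructor
  · intro a b; simpa [sat_imp, Formula.Sat, NumTerm.eval, ν] using ax .B2 a b S₀
  · intro a b; simpa [Formula.Sat, NumTerm.eval, ν] using ax .B4 a b S₀
  · intro a; simpa [Formula.Sat, NumTerm.eval, ν] using ax .B5 a a S₀
  · intro a b; simpa [Formula.Sat, NumTerm.eval, ν] using ax .B6 a b S₀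
  · intro a b; simpa [sat_imp, Formula.Sat, NumTerm.eval, ν] using ax .B7 a b S₀
  · intro a b; simpa [Formula.Sat, NumTerm.eval, ν] using ax .B8 a b S₀
  · intro a; simpa [Formula.Sat, NumTerm.eval, ν] using ax .B9 a a S₀
  · intro a b; simpa [Formula.Sat, NumTerm.eval, ν] using ax .B10 a b S₀
  · intro a b; simpa [sat_iff, sat_lt, Formula.Sat, NumTerm.eval, ν] using ax .B11 a b S₀
  · intro a ha
    have := ax .B12 a a S₀
    simp [sat_imp, Formula.ne, exLe, Formula.Sat, NumTerm.eval, ν, ha] at this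
    exact this.imp fun _ h => h.2
  · intro a S; simpa [sat_imp, sat_lt, Formula.Sat, NumTerm.eval, ν] using ax .L1 a a S
  · intro a S; simpa [sat_imp, Formula.Sat, NumTerm.eval, ν] using ax .L2 a a S

namespace BasicLaws

variable (B : BasicLaws M) {a b : M.Num}
include B

theorem le_refl (a : M.Num) : M.le a a := (B.le_total a a).elim id id

theorem ne_add_one (a : M.Num) : a ≠ M.add a M.one := ((B.le_iff a a).1 (B.le_refl a)).2

/-- If `b ≤ a`, then B11 gives `b < a + 1`, against `a + 1 ≤ b`. With its converse below, this
discreteness replaces transitivity of `≤`, which is not an axiom and is never needed. -/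
theorem lt_of_add_one_le (h : M.le (M.add a M.one) b) : M.Lt a b := by
  have hne : a ≠ b := by
    rintro rfl
    exact B.ne_add_one a (B.le_antisymm _ _ (B.le_add _ _) h)
  refine ⟨(B.le_total a b).resolve_right fun hba => ?_, hne⟩
  have := (B.le_iff b a).1 hba
  exact this.2 (B.le_antisymm _ _ this.1 h)

theorem add_one_le_of_lt (h : M.Lt a b) : M.le (M.add a M.one) b := by
  rcases B.le_total (M.add a M.one) b with h' | h'
  · exact h'
  by_cases hb : b = M.add a M.one
  · rw [hb]; exact B.le_refl _
  · exact absurd (B.le_antisymm _ _ h.1 ((B.le_iff b a).2 ⟨h', hb⟩)) h.2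

/-- Induction up to `z` for a property that agrees with a set of numbers `≤ z`. -/
theorem induction {P : M.Num → Prop} {z : M.Num} {S : M.Str}
    (hlen : M.le (M.len S) (M.add z M.one))
    (hS : ∀ x, M.Lt x (M.add z M.one) → (M.mem x S ↔ P x))
    (h0 : P M.zero) (hstep : ∀ x, P x → P (M.add x M.one)) : P z := by
  -- Since `0 ∈ S`, the length of `S` is nonzero, and its predecessor `w` is the largest element of
  -- `S`.
  have hpos := B.lt_len _ _ ((hS M.zero ((B.le_iff _ _).1 (B.zero_le z))).2 h0)
  obtain ⟨w, hw⟩ := B.exists_pred _ hpos.2.symm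
  have hwz : M.Lt w (M.add z M.one) := B.lt_of_add_one_le (hw ▸ hlen)
  have hPw := (hS w hwz).1 (B.mem_of_len w S hw)
  by_cases hne : w = z
  · exact hne ▸ hPw
  -- If `w < z`, then `w + 1` is still in range and the induction step puts it in `S`, although `w +
  -- 1 = |S|`.
  have hlt := (B.le_iff _ _).1 (B.add_one_le_of_lt ⟨(B.le_iff _ _).2 hwz, hne⟩)
  exact absurd hw (B.lt_len _ _ ((hS _ hlt).2 (hstep w hPw))).2

end BasicLaws

theorem IsModel.exists_comprehension (hM : IsModel M V0) {X y z : ℕ} {φ : Formula}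
    (hφ : φ.IsSigma0B) (hX : ¬ φ.FreeStr X) (hyz : y ≠ z) (ν : ℕ → M.Num) (σ : ℕ → M.Str) :
    ∃ S, M.le (M.len S) (ν y) ∧ ∀ x, M.Lt x (ν y) →
      (M.mem x S ↔ φ.Sat M (Function.update ν z x) (Function.update σ X S)) := by
  have := hM _ (Or.inr ⟨X, y, z, φ, hφ, hX, hyz, rfl⟩) ν σ
  simp [comprehension, exStrLe, Formula.Sat, sat_allLt, sat_iff, NumTerm.eval, hyz] at this
  exact this.imp fun S h => ⟨h.1, fun x hx => h.2 x hx.1 hx.2⟩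

theorem isSigma0B_imp {φ ψ : Formula} (hφ : φ.IsSigma0B) (hψ : ψ.IsSigma0B) :
    (φ.imp ψ).IsSigma0B := hφ.neg.or hψ

theorem isSigma0B_iff {φ ψ : Formula} (hφ : φ.IsSigma0B) (hψ : ψ.IsSigma0B) :
    (φ.iff ψ).IsSigma0B := (isSigma0B_imp hφ hψ).and (isSigma0B_imp hψ hφ)

theorem isSigma0B_exLt {x : ℕ} {t : NumTerm} {φ : Formula} (hx : ¬ t.HasVar x)
    (hφ : φ.IsSigma0B) : (exLt x t φ).IsSigma0B :=
  .exLe hx ((IsSigma0B.eqNum _ _).neg.and hφ)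

/-- The preimage of `W` under the composition of the maps coded by `Z` and `Z'`. -/
theorem IsModel.exists_preimage (hM : IsModel M V0) (k : M.Num) (V V' Z Z' W : M.Str) :
    ∃ A, ∀ x, M.Lt x k → (M.mem x A ↔ ∃ j, M.Lt j (M.len V) ∧ ∃ l, M.Lt l (M.len V') ∧
      M.mem (M.pr x j) Z ∧ M.mem (M.pr j l) Z' ∧ M.mem l W) := by
  let σ : ℕ → M.Str := fun n => match n with
    | 0 => V
    | 1 => V'
    | 2 => Z
    | 3 => Z'
    | _ => W
  have hφ : (exLt 2 (len 0) (exLt 3 (len 1) ((rel 2 (var 0) (var 2)).and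
      ((rel 3 (var 2) (var 3)).and (mem (var 3) 4))))).IsSigma0B :=
    isSigma0B_exLt (by simp [HasVar]) (isSigma0B_exLt (by simp [HasVar])
      ((IsSigma0B.mem _ _).and ((IsSigma0B.mem _ _).and (IsSigma0B.mem _ _))))
  -- Number variable `1`, absent from the formula, carries the bound `k`; string variable `5` is
  -- fresh.
  obtain ⟨A, -, hA⟩ := hM.exists_comprehension (X := 5) (y := 1) (z := 0) hφ
    (by simp [exLt, exLe, FreeStr, HasStr, rel, pair, Formula.ne]) (by decide) (fun _ => k) σ
  refine ⟨A, fun x hx => (hA x hx).trans ?_⟩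
  simp [sat_exLt, sat_rel, Formula.Sat, NumTerm.eval, σ, TwoSortedStructure.Lt, and_assoc]

/-- A set that alternates along the path `0, …, 2 * q` takes equal values at its ends. -/
theorem IsModel.mem_iff_of_alternating (hM : IsModel M V0) {p q : M.Num} {A : M.Str}
    (hq : M.mul (M.add M.one M.one) q = p)
    (hA : ∀ i, M.Lt i p → (M.mem i A ↔ ¬ M.mem (M.add i M.one) A)) :
    M.mem p A ↔ M.mem M.zero A := by
  have B := hM.basicLaws
  -- The induction formula is `2x ≤ p → (A(2x) ↔ A(0))`; the guard keeps each step inside the range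
  -- where alternation is known.
  have hφ : ((Formula.le (mul (add one one) (var 0)) (var 2)).imp
      ((mem (mul (add one one) (var 0)) 0).iff (mem zero 0))).IsSigma0B :=
    isSigma0B_imp (.le _ _) (isSigma0B_iff (.mem _ _) (.mem _ _))
  obtain ⟨S, hlen, hS⟩ := hM.exists_comprehension (X := 1) (y := 1) (z := 0) hφ
    (by simp [Formula.imp, Formula.iff, FreeStr, HasStr]) (by decide)
    -- The bound is `q + 1` so that the comprehended set decides `x = q` as well.
    (fun n => if n = 1 then M.add q M.one else p) (fun _ => A)
  simp [sat_imp, sat_iff, Formula.Sat, NumTerm.eval] at hlen hS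
  have := B.induction (P := fun x => M.le (M.mul (M.add M.one M.one) x) p →
    (M.mem (M.mul (M.add M.one M.one) x) A ↔ M.mem M.zero A)) hlen hS
    (fun _ => by rw [B.mul_zero]) fun x ih hx => by
      -- This rewrites `2(x + 1)` as `(2x + 1) + 1`; the two alternations, at `2x` and at `2x + 1`,
      -- then cancel.
      rw [B.mul_add_one, B.add_add_one] at hx ⊢
      have h1 := B.lt_of_add_one_le hx
      have h2 := B.lt_of_add_one_le h1.1
      have := ih h2.1
      have := hA _ h1
      have := hA _ h2
      tauto
  rw [hq] at this
  exact this (B.le_refl p)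

end Arithmetic

end BoundedArith

/-! ### The contradiction on the odd cycle -/

open BoundedArith in
theorem theorem3 : BoundedArith.Proves.{u, v} BoundedArith.V0 BoundedArith.noHomSentence := by
  intro M hM ν σ
  have B := hM.basicLaws
  simp only [noHomSentence, Formula.Sat, sat_imp]
  intro VG EG VH EH ⟨_, hH⟩ ⟨hbip, hnonbip⟩ hhom
  obtain ⟨W, hW⟩ := exists_coloring_of_sat_bip hH B.le_total hbip
  obtain ⟨p, q, C, Z, hq, hlast, hpath, hZ⟩ := exists_oddCycle_of_sat_nonbip hnonbip B.add_one_inj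
  obtain ⟨Z', hZ'⟩ := exists_isHom_of_sat_hom hhom
  simp at hW hZ hZ'
  obtain ⟨A, hA⟩ := hM.exists_preimage (M.add p M.one) VG VH Z Z' W
  -- `A` is defined by existence of images; as both maps are single-valued, any choice of images
  -- decides membership.
  have hAW : ∀ i, M.Lt i (M.add p M.one) → ∀ j, M.Lt j (M.len VG) → ∀ l, M.Lt l (M.len VH) →
      M.mem (M.pr i j) Z → M.mem (M.pr j l) Z' → (M.mem i A ↔ M.mem l W) := by
    intro i hi j hj l hl hij hjl
    refine (hA i hi).trans ⟨?_, fun h => ⟨j, hj, l, hl, hij, hjl, h⟩⟩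
    rintro ⟨j', hj', l', hl', hij', hjl', h⟩
    obtain rfl := hZ.unique i hi j hj j' hj' hij hij'
    obtain rfl := hZ'.unique j hj l hl l' hl' hjl hjl'
    exact h
  have halt : ∀ i, M.Lt i (M.add p M.one) → ∀ i', M.Lt i' (M.add p M.one) →
      M.mem (M.pr i i') C → (M.mem i A ↔ ¬ M.mem i' A) := by
    intro i hi i' hi' hE
    obtain ⟨j, hj, hij⟩ := hZ.total i hi
    obtain ⟨j', hj', hij'⟩ := hZ.total i' hi'
    obtain ⟨l, hl, hjl⟩ := hZ'.total j hj
    obtain ⟨l', hl', hjl'⟩ := hZ'.total j' hj'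
    rw [hAW i hi j hj l hl hij hjl, hAW i' hi' j' hj' l' hl' hij' hjl']
    exact hW l hl l' hl' (hZ'.edge j hj j' hj' l hl l' hl'
      (hZ.edge i hi i' hi' j hj j' hj' hE hij hij') hjl hjl')
  have hend := hM.mem_iff_of_alternating (A := A) hq fun i hi =>
    halt i ((B.le_iff _ _).1 hi.1) _ ((B.le_iff _ _).1 (B.add_one_le_of_lt hi)) (hpath i hi)
  -- The closing edge forces `0` and `p` to differ in `A`, against `hend`. The case `p = 0` needs no
  -- separate treatment.
  have := halt M.zero ((B.le_iff _ _).1 (B.zero_le p)) p ((B.le_iff _ _).1 (B.le_refl p)) hlast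
  tauto
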